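/- Let $P$ be a set of $n$ points in a metric space $(X,d)$ and let $1\le k\le n$. For $v\in P$ and $r\in\mathbb{R}$ let $B(v,r)=\{u\in P: d(v,u)\le r\}$, and let the fair radius $r_k(v)$ be the minimum $r$ with $|B(v,r)|\ge n/k$. For $\alpha\ge 0$, a set $C\subseteq P$ of $k$ centers is called $\alpha$-fair if $d(v,C):=\min_{c\in C}d(v,c)\le\alpha\, r_k(v)$ for every $v\in P$. The $k$-center cost of $C$ is $\mathrm{cost}(P,C)=\max_{v\in P}d(v,C)$, and $\mathrm{OPT}_\alpha(P)$ denotes the minimum cost of an $\alpha$-fair set of $k$ centers, with $\mathrm{OPT}_\alpha(P)=\infty$ if there is none. A set $S\subseteq P$ of $k$ centers is a $(\beta,\gamma)$-bicriteria approximate solution for $\alpha$-fair $k$-center if $\mathrm{cost}(P,S)\le\beta\cdot\mathrm{OPT}_\alpha(P)$ and $S$ is $(\gamma\alpha)$-fair. **Theorem.** There is a polynomial-time algorithm which, given $\alpha\ge 1$, $\varepsilon>0$, $1\le k\le n$ and the distance matrix of any set $P$ of $n$ distinct points in any metric space, computes a $(3+\varepsilon,3)$-bicriteria approximate solution for $\alpha$-fair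 $k$-center on $P$. Here an algorithm is a program for a random access machine that works on natural numbers and real numbers (kept in variables and in two-dimensional tables), where one step is an assignment of a constant, a copy, a read or write of a table entry, an addition or a subtraction, a multiplication of a real by one of the real inputs $\alpha,\varepsilon$, or a comparison of two naturals or of two reals; polynomial-time means that the number of steps is at most a fixed polynomial in $n$ (the same for all $k$, $\alpha$, $\varepsilon$ and all metrics). -/

import Mathlib

open scoped ENNReal

namespace FairKCenter

noncomputable section

/-! ### Individually fair `k`-center -/

section Problem

variable {X : Type*} [MetricSpace X]

/-- The ball `B(v, r)` inside the finite point set `P`. -/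
def ball (P : Finset X) (v : X) (r : ℝ) : Finset X := by
  classical exact P.filter fun u => dist v u ≤ r

/-- The fair radius of `v`: the minimum `r` such that the ball of radius `r` around `v` contains
at least `|P| / k` points of `P`. -/
def fairRadius (P : Finset X) (k : ℕ) (v : X) : ℝ :=
  sInf {r : ℝ | (P.card : ℝ) / (k : ℝ) ≤ ((ball P v r).card : ℝ)}

/-- `C` is an `α`-fair `k`-clustering of `P`: a set of `k` centers in `P` such that every point
`v` of `P` has a center within distance `α` times its fair radius. -/
def IsFair (P : Finset X) (k : ℕ) (α : ℝ) (C : Finset X) : Prop :=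
  C ⊆ P ∧ C.card = k ∧ ∀ v ∈ P, Metric.infDist v (C : Set X) ≤ α * fairRadius P k v

/-- The `k`-center cost of `C`: the largest distance of a point of `P` to its closest center. -/
def cost (P C : Finset X) : ℝ := ⨆ v : P, Metric.infDist (v : X) (C : Set X)

/-- The optimal cost of an `α`-fair `k`-clustering of `P`; it is `∞` if there is none. -/
def optCost (P : Finset X) (k : ℕ) (α : ℝ) : ℝ≥0∞ :=
  ⨅ (C : Finset X) (_ : IsFair P k α C), ENNReal.ofReal (cost P C)

/-- `S` is a `(β, γ)`-bicriteria approximate solution for `α`-fair `k`-center on `P`. -/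
def IsBicriteriaApprox (P : Finset X) (k : ℕ) (α β γ : ℝ) (S : Finset X) : Prop :=
  ENNReal.ofReal (cost P S) ≤ ENNReal.ofReal β * optCost P k α ∧ IsFair P k (γ * α) S

end Problem

/-! ### Random access machines over the reals

A program works on natural-number variables, real variables, two-dimensional tables of naturals
and of reals, and read-only real parameters. Each program mentions only finitely many variables,
tables and parameters. Every elementary instruction and every evaluation of a test takes one step.

The arithmetic is deliberately restricted: naturals are only added and subtracted, reals are only
added, subtracted, compared and multiplied by a parameter. (There is no rounding, no conversion of
reals to integers and no repeated squaring, so on rational inputs the bit length of the numbers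
that occur stays polynomial in the number of steps and the bit length of the input.) -/

/-- The memory of the machine. -/
structure Store where
  /-- natural-number variables -/
  ivar : ℕ → ℕ
  /-- tables of naturals: `itab a i j` is the entry `(i, j)` of table `a` -/
  itab : ℕ → ℕ → ℕ → ℕ
  /-- real variables -/
  rvar : ℕ → ℝ
  /-- tables of reals: `rtab a i j` is the entry `(i, j)` of table `a` -/
  rtab : ℕ → ℕ → ℕ → ℝ
  /-- read-only real parameters -/
  par : ℕ → ℝ

/-- Elementary instructions; the arguments are names of variables, tables and parameters, and
constants `c`. -/
inductive Instr where
  /-- `x := c` -/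
  | iconst (x c : ℕ)
  /-- `x := y` -/
  | icopy (x y : ℕ)
  /-- `x := y + z` -/
  | iadd (x y z : ℕ)
  /-- `x := max (y - z) 0` -/
  | isub (x y z : ℕ)
  /-- `x := a[i, j]` -/
  | iload (x a i j : ℕ)
  /-- `a[i, j] := x` -/
  | istore (a i j x : ℕ)
  /-- `x := c` -/
  | rconst (x : ℕ) (c : ℚ)
  /-- `x := y` -/
  | rcopy (x y : ℕ)
  /-- `x := y + z` -/
  | radd (x y z : ℕ)
  /-- `x := y - z` -/
  | rsub (x y z : ℕ)
  /-- `x := p * y` for a parameter `p` -/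
  | rscale (x p y : ℕ)
  /-- `x := a[i, j]` -/
  | rload (x a i j : ℕ)
  /-- `a[i, j] := x` -/
  | rstore (a i j x : ℕ)

/-- The table entry `t[a, i, j]` is overwritten by `v`. -/
def setEntry {V : Type} (t : ℕ → ℕ → ℕ → V) (a i j : ℕ) (v : V) : ℕ → ℕ → ℕ → V :=
  fun a' i' j' => if a' = a ∧ i' = i ∧ j' = j then v else t a' i' j'

/-- The effect of an elementary instruction. -/
def Instr.exec : Instr → Store → Store
  | .iconst x c, s => { s with ivar := Function.update s.ivar x c }
  | .icopy x y, s => { s with ivar := Function.update s.ivar x (s.ivar y) }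
  | .iadd x y z, s => { s with ivar := Function.update s.ivar x (s.ivar y + s.ivar z) }
  | .isub x y z, s => { s with ivar := Function.update s.ivar x (s.ivar y - s.ivar z) }
  | .iload x a i j, s =>
      { s with ivar := Function.update s.ivar x (s.itab a (s.ivar i) (s.ivar j)) }
  | .istore a i j x, s =>
      { s with itab := setEntry s.itab a (s.ivar i) (s.ivar j) (s.ivar x) }
  | .rconst x c, s => { s with rvar := Function.update s.rvar x (c : ℝ) }
  | .rcopy x y, s => { s with rvar := Function.update s.rvar x (s.rvar y) }
  | .radd x y z, s => { s with rvar := Function.update s.rvar x (s.rvar y + s.rvar z) }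
  | .rsub x y z, s => { s with rvar := Function.update s.rvar x (s.rvar y - s.rvar z) }
  | .rscale x p y, s => { s with rvar := Function.update s.rvar x (s.par p * s.rvar y) }
  | .rload x a i j, s =>
      { s with rvar := Function.update s.rvar x (s.rtab a (s.ivar i) (s.ivar j)) }
  | .rstore a i j x, s =>
      { s with rtab := setEntry s.rtab a (s.ivar i) (s.ivar j) (s.rvar x) }

/-- Tests: comparison of two natural-number variables or of two real variables. -/
inductive Test where
  /-- `x ≤ y` for naturals -/
  | ile (x y : ℕ)
  /-- `x ≤ y` for reals -/
  | rle (x y : ℕ)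

/-- The outcome of a test. -/
def Test.holds : Test → Store → Prop
  | .ile x y, s => s.ivar x ≤ s.ivar y
  | .rle x y, s => s.rvar x ≤ s.rvar y

/-- Programs. -/
inductive Program where
  /-- an elementary instruction -/
  | instr (i : Instr)
  /-- sequential composition -/
  | seq (p q : Program)
  /-- `if b then p else q` -/
  | cond (b : Test) (p q : Program)
  /-- `while b do p` -/
  | loop (b : Test) (p : Program)

/-- `Runs p s s' t`: started on the store `s`, the program `p` halts after exactly `t` steps with
the store `s'`. -/
inductive Runs : Program → Store → Store → ℕ → Prop
  | instr (i : Instr) (s : Store) : Runs (.instr i) s (i.exec s) 1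
  | seq {p q : Program} {s s' s'' : Store} {t t' : ℕ} :
      Runs p s s' t → Runs q s' s'' t' → Runs (.seq p q) s s'' (t + t')
  | cond_pos {b : Test} {p q : Program} {s s' : Store} {t : ℕ} :
      b.holds s → Runs p s s' t → Runs (.cond b p q) s s' (t + 1)
  | cond_neg {b : Test} {p q : Program} {s s' : Store} {t : ℕ} :
      ¬ b.holds s → Runs q s s' t → Runs (.cond b p q) s s' (t + 1)
  | loop_pos {b : Test} {p : Program} {s s' s'' : Store} {t t' : ℕ} :
      b.holds s → Runs p s s' t → Runs (.loop b p) s' s'' t' →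
        Runs (.loop b p) s s'' (t + t' + 1)
  | loop_neg {b : Test} {p : Program} {s : Store} :
      ¬ b.holds s → Runs (.loop b p) s s 1

/-! ### Input and output conventions -/

/-- The initial store for the points `x 0, …, x (n - 1)`: natural-number variables `0` and `1`
hold `n` and `k`, the parameters `0` and `1` are `α` and `ε`, real table `0` is the distance
matrix, and everything else is `0`. -/
def inputStore {X : Type*} [MetricSpace X] {n : ℕ} (x : Fin n ↪ X) (k : ℕ) (α ε : ℝ) : Store where
  ivar v := if v = 0 then n else if v = 1 then k else 0
  itab _ _ _ := 0
  rvar _ := 0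
  rtab a i j :=
    if h : a = 0 ∧ i < n ∧ j < n then dist (x ⟨i, h.2.1⟩) (x ⟨j, h.2.2⟩) else 0
  par p := if p = 0 then α else if p = 1 then ε else 0

/-- The set of centers returned by the machine: the points `x i` such that the entry `(i, 0)` of
table `0` of naturals is `1`. -/
def outputSet {X : Type*} {n : ℕ} (x : Fin n ↪ X) (s : Store) : Finset X :=
  (Finset.univ.filter fun i : Fin n => s.itab 0 i 0 = 1).map x

end

end FairKCenter

/-! One greedy algorithm gives the stronger factors `(2, 2)`. Call `w v = 2 * α * r v` the coverage
radius of `v`, with `r v` its fair radius, and let `m v` be the distance from `v` to the centers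
chosen so far. In each of `k` rounds choose an uncovered point (`w v < m v`) of least coverage
radius if there is one, and otherwise a point maximizing `m`.

Fairness: if `u` is uncovered at the end, it was uncovered in every round, so every center was
chosen by the first rule and coverage radii increased weakly up to `w u`. Any two of the `k + 1`
points consisting of `u` and the centers are then farther apart than the mean of their coverage
radii, hence than the sum of their fair radii. Their fair balls are disjoint and each holds at least
`n / k` points, which is impossible (`card_le_of_separated`).

Cost: let `C` be `α`-fair and suppose `m u > 2 * cost P C`. Two centers `a`, `b` satisfy either `α *
r a + α * r b < dist a b` (the later one was chosen as uncovered) or `m u ≤ dist a b` (it was chosen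
as farthest); pairs containing `u` satisfy the second bound. In either case `a` and `b` cannot share
a closest center in `C`: by fairness of `C` in the first case, by its cost in the second. So `C`
would have `k + 1` centers (`card_le_of_no_common_center`).

`GreedyInv` is the invariant behind both arguments. For the machine, the algorithm is written with
counting loops of length `n` only, so that it has a total semantics `den` and a polynomial time
bound read off the syntax; `runs_compile` transfers both to the actual machine. -/

namespace FairKCenter

/-! ### Programs with counting loops -/

/-- Programs whose only loops run a counter through `0, …, n - 1`. -/
inductive ForProgram where
  /-- an elementary instruction -/
  | instr (i : Instr)
  /-- sequential composition -/
  | seq (p q : ForProgram)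
  /-- `if b then p else q` -/
  | cond (b : Test) (p q : ForProgram)
  /-- `for c < n do p` -/
  | loop (c : ℕ) (p : ForProgram)

/-- The store with the natural-number variable `c` set to `i`. -/
def Store.setI (s : Store) (c i : ℕ) : Store := { s with ivar := Function.update s.ivar c i }

namespace Instr

/-- Does the instruction write to the natural-number variable `x`? -/
def writesIvar : Instr → ℕ → Bool
  | iconst y _, x | icopy y _, x | iadd y _ _, x | isub y _ _, x | iload y _ _ _, x => x == y
  | _, _ => false

/-- Does the instruction write to the table `a` of naturals? -/
def writesItab : Instr → ℕ → Bool
  | istore b _ _ _, a => a == b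
  | _, _ => false

/-- Does the instruction write to the real variable `x`? -/
def writesRvar : Instr → ℕ → Bool
  | rconst y _, x | rcopy y _, x | radd y _ _, x | rsub y _ _, x | rscale y _ _, x
  | rload y _ _ _, x => x == y
  | _, _ => false

/-- Does the instruction write to the table `a` of reals? -/
def writesRtab : Instr → ℕ → Bool
  | rstore b _ _ _, a => a == b
  | _, _ => false

end Instr

namespace ForProgram

/-- Does the program write to the natural-number variable `x`? -/
def writesIvar : ForProgram → ℕ → Bool
  | instr i, x => i.writesIvar x
  | seq p q, x | cond _ p q, x => p.writesIvar x || q.writesIvar x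
  | loop c p, x => x == c || p.writesIvar x

/-- Does the program write to the table `a` of naturals? -/
def writesItab : ForProgram → ℕ → Bool
  | instr i, a => i.writesItab a
  | seq p q, a | cond _ p q, a => p.writesItab a || q.writesItab a
  | loop _ p, a => p.writesItab a

/-- Does the program write to the real variable `x`? -/
def writesRvar : ForProgram → ℕ → Bool
  | instr i, x => i.writesRvar x
  | seq p q, x | cond _ p q, x => p.writesRvar x || q.writesRvar x
  | loop _ p, x => p.writesRvar x

/-- Does the program write to the table `a` of reals? -/
def writesRtab : ForProgram → ℕ → Bool
  | instr i, a => i.writesRtab a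
  | seq p q, a | cond _ p q, a => p.writesRtab a || q.writesRtab a
  | loop _ p, a => p.writesRtab a

/-- No loop body writes to the counter of its loop. -/
def WellFormed : ForProgram → Bool
  | instr _ => true
  | seq p q | cond _ p q => p.WellFormed && q.WellFormed
  | loop c p => p.WellFormed && !p.writesIvar c

/-- The state after `i` rounds of a loop with counter `c` whose body acts by `f`. -/
def iterate (f : Store → Store) (c : ℕ) (s : Store) : ℕ → Store
  | 0 => s.setI c 0
  | i + 1 => (f (iterate f c s i)).setI c (i + 1)

open Classical in
/-- The effect of a program, when its loops run `n` times. -/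
noncomputable def den (n : ℕ) : ForProgram → Store → Store
  | instr i, s => i.exec s
  | seq p q, s => den n q (den n p s)
  | cond b p q, s => if b.holds s then den n p s else den n q s
  | loop c p, s => iterate (den n p) c s n

/-- Translation into the language of the machine; the variables `2` and `3` hold `1` and
`n - 1`. -/
def compile : ForProgram → Program
  | instr i => .instr i
  | seq p q => .seq p.compile q.compile
  | cond b p q => .cond b p.compile q.compile
  | loop c p => .seq (.instr (.iconst c 0))
      (.loop (.ile c 3) (.seq p.compile (.instr (.iadd c c 2))))

/-- A bound on the running time. -/
noncomputable def time : ForProgram → Polynomial ℕ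
  | instr _ => 1
  | seq p q | cond _ p q => p.time + q.time + 1
  | loop _ p => Polynomial.X * (p.time + 2) + 2

/-! ### Frame conditions and correctness of the translation. -/

/-- The stores `s` and `s'` agree on everything that `p` does not write to. -/
structure Frame (p : ForProgram) (s s' : Store) : Prop where
  ivar : ∀ x, p.writesIvar x = false → s'.ivar x = s.ivar x
  itab : ∀ a, p.writesItab a = false → s'.itab a = s.itab a
  rvar : ∀ x, p.writesRvar x = false → s'.rvar x = s.rvar x
  rtab : ∀ a, p.writesRtab a = false → s'.rtab a = s.rtab a
  par : s'.par = s.par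

theorem Frame.trans {p : ForProgram} {s s' s'' : Store} (h : Frame p s s') (h' : Frame p s' s'') :
    Frame p s s'' :=
  ⟨fun x hx => (h'.ivar x hx).trans (h.ivar x hx), fun x hx => (h'.itab x hx).trans (h.itab x hx),
    fun x hx => (h'.rvar x hx).trans (h.rvar x hx), fun x hx => (h'.rtab x hx).trans (h.rtab x hx),
    h'.par.trans h.par⟩

theorem Frame.mono {p q : ForProgram} {s s' : Store} (h : Frame p s s')
    (hi : ∀ x, q.writesIvar x = false → p.writesIvar x = false)
    (ha : ∀ x, q.writesItab x = false → p.writesItab x = false)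
    (hr : ∀ x, q.writesRvar x = false → p.writesRvar x = false)
    (hb : ∀ x, q.writesRtab x = false → p.writesRtab x = false) : Frame q s s' :=
  ⟨fun x hx => h.ivar x (hi x hx), fun x hx => h.itab x (ha x hx),
    fun x hx => h.rvar x (hr x hx), fun x hx => h.rtab x (hb x hx), h.par⟩

theorem frame_instr (i : Instr) (s : Store) : Frame (instr i) s (i.exec s) := by
  constructor
  · intro x hx
    cases i <;>
      simp_all [writesIvar, Instr.writesIvar, Instr.exec]
  · intro x hx
    cases i <;>
      simp_all [writesItab, Instr.writesItab, Instr.exec]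
    funext
    simp_all [setEntry]
  · intro x hx
    cases i <;>
      simp_all [writesRvar, Instr.writesRvar, Instr.exec]
  · intro x hx
    cases i <;>
      simp_all [writesRtab, Instr.writesRtab, Instr.exec]
    funext
    simp_all [setEntry]
  · cases i <;> rfl

theorem frame_setI (c i : ℕ) (p : ForProgram) (s : Store) : Frame (loop c p) s (s.setI c i) := by
  refine ⟨fun x hx => ?_, fun _ _ => rfl, fun _ _ => rfl, fun _ _ => rfl, rfl⟩
  simp_all [writesIvar, Store.setI]

theorem frame_iterate {f : Store → Store} {p : ForProgram} (hf : ∀ s, Frame p s (f s)) (c : ℕ)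
    (s : Store) (i : ℕ) : Frame (loop c p) s (iterate f c s i) := by
  induction i with
  | zero => exact frame_setI c 0 p s
  | succ i ih =>
    refine ih.trans (Frame.trans ((hf _).mono ?_ ?_ ?_ ?_) (frame_setI c (i + 1) p _)) <;>
      simp [writesIvar, writesItab, writesRvar, writesRtab]

/-- The write sets are Boolean functions of the syntax, so for a concrete program each preserved
variable or table is obtained from this lemma with side condition `rfl`. -/
theorem frame_den (n : ℕ) (p : ForProgram) (s : Store) : Frame p s (p.den n s) := by
  induction p generalizing s with
  | instr i => exact frame_instr i s
  | seq p q hp hq =>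
    refine Frame.trans ((hp s).mono ?_ ?_ ?_ ?_) ((hq _).mono ?_ ?_ ?_ ?_) <;>
      simp +contextual [writesIvar, writesItab, writesRvar, writesRtab]
  | cond b p q hp hq =>
    rw [den]
    split_ifs
    · refine (hp s).mono ?_ ?_ ?_ ?_ <;>
        simp +contextual [writesIvar, writesItab, writesRvar, writesRtab]
    · refine (hq s).mono ?_ ?_ ?_ ?_ <;>
        simp +contextual [writesIvar, writesItab, writesRvar, writesRtab]
  | loop c p hp => exact frame_iterate hp c s n

/-- The invariant rule for loops: to maintain `I`, one may use that everything the loop does not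
write to is unchanged. -/
theorem den_loop_induction {n c : ℕ} {p : ForProgram} {s : Store} (I : ℕ → Store → Prop)
    (zero : I 0 (s.setI c 0))
    (succ : ∀ i < n, ∀ s', Frame (loop c p) s s' → s'.ivar c = i → I i s' →
      I (i + 1) ((p.den n s').setI c (i + 1))) :
    I n ((loop c p).den n s) := by
  suffices h : ∀ i ≤ n, I i (iterate (p.den n) c s i) from h n le_rfl
  intro i
  induction i with
  | zero => exact fun _ => zero
  | succ i ih =>
    intro hi
    refine succ i hi _ (frame_iterate (frame_den n p) c s i) ?_ (ih (by omega))
    cases i <;> simp [iterate, Store.setI]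

/-- A well-formed program that leaves the variables `2` and `3` alone is translated correctly. -/
theorem runs_compile {n : ℕ} (p : ForProgram) (hp : p.WellFormed) (h2 : p.writesIvar 2 = false)
    (h3 : p.writesIvar 3 = false) (s : Store) (hs2 : s.ivar 2 = 1) (hs3 : s.ivar 3 + 1 = n) :
    ∃ t, Runs p.compile s (p.den n s) t ∧ t ≤ p.time.eval n := by
  induction p generalizing s with
  | instr i => exact ⟨1, .instr i s, by simp [time]⟩
  | seq p q ihp ihq =>
    simp only [WellFormed, Bool.and_eq_true, writesIvar, Bool.or_eq_false_iff] at hp h2 h3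
    obtain ⟨t, ht, htle⟩ := ihp hp.1 h2.1 h3.1 s hs2 hs3
    obtain ⟨t', ht', htle'⟩ := ihq hp.2 h2.2 h3.2 (p.den n s)
      (((frame_den n p s).ivar 2 h2.1).trans hs2) (by rw [(frame_den n p s).ivar 3 h3.1, hs3])
    exact ⟨t + t', .seq ht ht', by simp [time]; omega⟩
  | cond b p q ihp ihq =>
    simp only [WellFormed, Bool.and_eq_true, writesIvar, Bool.or_eq_false_iff] at hp h2 h3
    by_cases hb : b.holds s
    · obtain ⟨t, ht, htle⟩ := ihp hp.1 h2.1 h3.1 s hs2 hs3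
      exact ⟨t + 1, by simpa [den, hb, compile] using .cond_pos hb ht, by simp [time]; omega⟩
    · obtain ⟨t, ht, htle⟩ := ihq hp.2 h2.2 h3.2 s hs2 hs3
      exact ⟨t + 1, by simpa [den, hb, compile] using .cond_neg hb ht, by simp [time]; omega⟩
  | loop c p ih =>
    have h2' := h2
    have h3' := h3
    simp only [WellFormed, Bool.and_eq_true, writesIvar, Bool.or_eq_false_iff,
      Bool.not_eq_true', beq_eq_false_iff_ne] at hp h2 h3
    -- A run of a loop is built from its first round on, so the induction is on the number `j` of
    -- remaining rounds. Each round costs the body, one test and one increment; the last test costs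
    -- one more step.
    have key : ∀ j i, i + j = n → ∃ t,
        Runs (.loop (.ile c 3) (.seq p.compile (.instr (.iadd c c 2))))
          (iterate (p.den n) c s i) (iterate (p.den n) c s n) t ∧
        t ≤ j * (p.time.eval n + 2) + 1 := by
      intro j
      induction j with
      | zero =>
        rintro i rfl
        -- The counter is now `n`, while variable `3` holds `n - 1`, so the test fails.
        refine ⟨1, .loop_neg ?_, by simp⟩
        have hf := (frame_iterate (frame_den (i + 0) p) c s i).ivar 3 h3'
        have hc : (iterate (p.den (i + 0)) c s i).ivar c = i := by
          cases i <;> simp [iterate, Store.setI]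
        simp only [Test.holds, hf, hc]
        omega
      | succ j ihj =>
        intro i hi
        have hf3 := (frame_iterate (frame_den n p) c s i).ivar 3 h3'
        have hf2 := (frame_iterate (frame_den n p) c s i).ivar 2 h2'
        have hc : (iterate (p.den n) c s i).ivar c = i := by
          cases i <;> simp [iterate, Store.setI]
        obtain ⟨t, ht, htle⟩ := ih hp.1 h2.2 h3.2 _ (hf2.trans hs2) (by rw [hf3, hs3])
        obtain ⟨t', ht', htle'⟩ := ihj (i + 1) (by omega)
        have hstep : (Instr.iadd c c 2).exec (p.den n (iterate (p.den n) c s i)) =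
            iterate (p.den n) c s (i + 1) := by
          have e2 := (frame_den n p (iterate (p.den n) c s i)).ivar 2 h2.2
          have ec := (frame_den n p (iterate (p.den n) c s i)).ivar c hp.2
          simp only [Instr.exec, iterate, Store.setI, e2, ec, hf2, hc, hs2]
        refine ⟨t + 1 + t' + 1, .loop_pos ?_ (.seq ht (.instr _ _)) (hstep ▸ ht'), ?_⟩
        · simp only [Test.holds, hf3, hc]
          omega
        · rw [add_mul]
          omega
    obtain ⟨t, ht, htle⟩ := key n 0 (by omega)
    exact ⟨1 + t, .seq (.instr _ _) ht, by simp [time]; omega⟩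

end ForProgram

/-! ### Fair radii and the two counting arguments. -/

section Geometry

variable {X : Type*} [MetricSpace X]

theorem mem_ball {P : Finset X} {v u : X} {r : ℝ} : u ∈ ball P v r ↔ u ∈ P ∧ dist v u ≤ r := by
  simp [ball]

/-- A radius whose ball is large enough, and which is minimal among the distances with this
property, is the fair radius. -/
theorem fairRadius_eq {P : Finset X} {k : ℕ} (hk : 1 ≤ k) {v : X} {r : ℝ} (hv : v ∈ P)
    (hr : (P.card : ℝ) / k ≤ (ball P v r).card)
    (hmin : ∀ u ∈ P, (P.card : ℝ) / k ≤ (ball P v (dist v u)).card → r ≤ dist v u) :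
    fairRadius P k v = r := by
  refine IsLeast.csInf_eq ⟨hr, fun q hq => ?_⟩
  have hq : (P.card : ℝ) / k ≤ (ball P v q).card := hq
  have hP : 0 < P.card := Finset.card_pos.2 ⟨v, hv⟩
  have hne : (ball P v q).Nonempty := by
    rw [← Finset.card_pos, ← Nat.cast_pos (α := ℝ)]
    refine lt_of_lt_of_le ?_ hq
    positivity
  -- Shrinking `q` to the distance of the farthest point in its ball loses no point, so it suffices
  -- to compare `r` with distances.
  obtain ⟨u, hu, hmax⟩ := (ball P v q).exists_max_image (dist v) hne
  obtain ⟨huP, huq⟩ := mem_ball.1 hu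
  refine (hmin u huP (hq.trans ?_)).trans huq
  exact_mod_cast Finset.card_le_card fun x hx =>
    mem_ball.2 ⟨(mem_ball.1 hx).1, hmax x hx⟩

/-- Points whose balls are large and pairwise disjoint are few. -/
theorem card_le_of_separated {P T : Finset X} {k : ℕ} (hk : 1 ≤ k) {r : X → ℝ} (hT : T ⊆ P)
    (hr : ∀ v ∈ T, (P.card : ℝ) / k ≤ (ball P v (r v)).card)
    (hsep : ∀ a ∈ T, ∀ b ∈ T, a ≠ b → r a + r b < dist a b) : T.card ≤ k := by
  classical
  rcases T.eq_empty_or_nonempty with rfl | ⟨v, hv⟩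
  · simp
  have hP : (0 : ℝ) < P.card := Nat.cast_pos.2 (Finset.card_pos.2 ⟨v, hT hv⟩)
  have hk' : (0 : ℝ) < k := Nat.cast_pos.2 hk
  have hdisj : (T.biUnion fun v => ball P v (r v)).card = ∑ v ∈ T, (ball P v (r v)).card := by
    refine Finset.card_biUnion fun a ha b hb hab => Finset.disjoint_left.2 fun x hxa hxb => ?_
    have h := dist_triangle_right a b x
    linarith [hsep a ha b hb hab, (mem_ball.1 hxa).2, (mem_ball.1 hxb).2]
  have hle : (T.biUnion fun v => ball P v (r v)).card ≤ P.card :=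
    Finset.card_le_card (Finset.biUnion_subset.2 fun a _ x hx => (mem_ball.1 hx).1)
  have hsum : (T.card : ℝ) * (P.card / k) ≤ P.card := by
    calc (T.card : ℝ) * (P.card / k) = ∑ v ∈ T, (P.card : ℝ) / k := by simp
      _ ≤ ∑ v ∈ T, ((ball P v (r v)).card : ℝ) := Finset.sum_le_sum hr
      _ ≤ P.card := by rw [hdisj] at hle; exact_mod_cast hle
  rw [mul_div_assoc', div_le_iff₀ hk', mul_comm] at hsum
  exact_mod_cast le_of_mul_le_mul_left hsum hP

/-- If no two points of `T` can share a closest center, then `T` is no larger than `C`. -/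
theorem card_le_of_no_common_center {T C : Finset X} (hC : C.Nonempty)
    (h : ∀ a ∈ T, ∀ b ∈ T, a ≠ b →
      Metric.infDist a (C : Set X) + Metric.infDist b (C : Set X) < dist a b) :
    T.card ≤ C.card := by
  have hnear : ∀ a : X, ∃ c ∈ C, Metric.infDist a (C : Set X) = dist a c := fun a =>
    C.finite_toSet.isCompact.exists_infDist_eq_dist hC a
  choose f hf hfd using hnear
  -- The closest-center map `f` is injective on `T`: a shared center would bound `dist a b` by the
  -- sum of the two distances to `C`.
  refine Finset.card_le_card_of_injOn f (fun a _ => hf a) fun a ha b hb hab => ?_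
  by_contra hne
  have hb' := hfd b
  rw [← hab] at hb'
  linarith [h a ha b hb hne, hfd a, dist_triangle_right a b (f a)]

theorem infDist_le_cost {P : Finset X} (C : Finset X) {v : X} (hv : v ∈ P) :
    Metric.infDist v (C : Set X) ≤ cost P C :=
  le_ciSup (f := fun v : P => Metric.infDist (v : X) (C : Set X))
    (Set.finite_range _).bddAbove ⟨v, hv⟩

end Geometry

/-! ### The greedy selection and its invariant. -/

section Greedy

variable {X : Type*} [MetricSpace X]

/-- The state of the greedy algorithm on the points `y 0, …, y (n - 1)` with coverage radii `w`:
`S` is the set of centers chosen so far and `m` is the distance to `S`. -/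
structure GreedyInv (n : ℕ) (y : ℕ → X) (w : ℕ → ℝ) (S : Finset ℕ) (m : ℕ → ℝ) : Prop where
  subset : S ⊆ Finset.range n
  le_dist : ∀ u < n, ∀ c ∈ S, m u ≤ dist (y u) (y c)
  attained : ∀ u < n, (S = ∅ ∧ w u < m u ∧ ∀ v < n, dist (y u) (y v) ≤ m u) ∨
    ∃ c ∈ S, m u = dist (y u) (y c)
  far : ∀ u < n, ∀ a ∈ S, ∀ b ∈ S, a ≠ b →
    w a + w b < 2 * dist (y a) (y b) ∨ m u ≤ dist (y a) (y b)
  uncovered : ∀ u < n, w u < m u → (∀ a ∈ S, w a ≤ w u) ∧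
    ∀ a ∈ S, ∀ b ∈ S, a ≠ b → w a + w b < 2 * dist (y a) (y b)

/-- The selection rule: an uncovered point of least coverage radius, if there is one, and
otherwise a point farthest from the centers. -/
def IsChoice (n : ℕ) (w m : ℕ → ℝ) (c : ℕ) : Prop :=
  c < n ∧ ((w c < m c ∧ ∀ u < n, w u < m u → w c ≤ w u) ∨
    ((∀ u < n, m u ≤ w u) ∧ ∀ u < n, m u ≤ m c))

namespace GreedyInv

variable {n : ℕ} {y : ℕ → X} {w : ℕ → ℝ} {S : Finset ℕ} {m : ℕ → ℝ}

/-- The value `B` stands for an infinite distance to the empty set: it exceeds all coverage radii,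
so every point starts uncovered, and it dominates all distances, so the first minimum is the
distance to the first center. -/
theorem empty {B : ℝ} (hw : ∀ u < n, w u < B) (hd : ∀ u < n, ∀ v < n, dist (y u) (y v) ≤ B)
    (hm : ∀ u < n, m u = B) : GreedyInv n y w ∅ m where
  subset := by simp
  le_dist := by simp
  attained u hu := .inl ⟨rfl, by rw [hm u hu]; exact hw u hu, by rw [hm u hu]; exact hd u hu⟩
  far := by simp
  uncovered := by simp

/-- A chosen point has `m c > 0`, whereas `m ≤ 0` on `S`. Under the farthest-point rule positivity
comes from a point outside `S`, which exists because `S.card < n` and has positive `m` because the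
points are distinct. This ensures that each round adds a new center. -/
theorem notMem_of_isChoice (h : GreedyInv n y w S m) (hw : ∀ u < n, 0 ≤ w u)
    (hy : Set.InjOn y (Set.Iio n)) (hS : S.card < n) {c : ℕ} (hc : IsChoice n w m c) : c ∉ S := by
  have hpos : 0 < m c := by
    obtain ⟨hcn, ⟨h1, -⟩ | ⟨-, h2⟩⟩ := hc
    · exact (hw c hcn).trans_lt h1
    · obtain ⟨u, hu, huS⟩ := Finset.exists_mem_notMem_of_card_lt_card
        (s := S) (t := Finset.range n) (by simpa using hS)
      have hun : u < n := Finset.mem_range.1 hu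
      refine lt_of_lt_of_le ?_ (h2 u hun)
      rcases h.attained u hun with ⟨-, h3, -⟩ | ⟨a, ha, h3⟩
      · exact (hw u hun).trans_lt h3
      · rw [h3, dist_pos]
        intro hya
        exact huS (hy hun (Finset.mem_range.1 (h.subset ha)) hya ▸ ha)
  intro hcS
  have := h.le_dist c hc.1 c hcS
  rw [dist_self] at this
  linarith

/-- Since `m` only decreases, the old separation bounds persist and a point uncovered now was
uncovered before. Only the pairs containing `c` need an argument, by the rule that selected `c`. -/
theorem insert (h : GreedyInv n y w S m) {c : ℕ} (hc : IsChoice n w m c) {m' : ℕ → ℝ}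
    (hm : ∀ u < n, m' u = min (m u) (dist (y u) (y c))) :
    GreedyInv n y w (insert c S) m' := by
  obtain ⟨hcn, hc⟩ := hc
  have hle : ∀ u < n, m' u ≤ m u := fun u hu => by rw [hm u hu]; exact min_le_left _ _
  -- If `c` is uncovered, `dist (y c) (y a) ≥ m c > w c ≥ w a`. If `c` is farthest, `m u ≤ m c ≤
  -- dist (y c) (y a)`.
  have hsep : ∀ u < n, ∀ a ∈ S, w a + w c < 2 * dist (y c) (y a) ∨ m u ≤ dist (y c) (y a) := by
    intro u hu a ha
    have h1 := h.le_dist c hcn a ha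
    rcases hc with ⟨h2, -⟩ | ⟨-, h3⟩
    · left
      linarith [(h.uncovered c hcn h2).1 a ha]
    · right
      linarith [h3 u hu]
  -- An uncovered `u` excludes the farthest-point rule.
  have hsep' : ∀ u < n, w u < m u → ∀ a ∈ S, w a + w c < 2 * dist (y c) (y a) := by
    intro u hu hwu a ha
    have h1 := h.le_dist c hcn a ha
    rcases hc with ⟨h2, -⟩ | ⟨h2, -⟩
    · linarith [(h.uncovered c hcn h2).1 a ha]
    · linarith [h2 u hu]
  refine ⟨?_, ?_, ?_, ?_, ?_⟩
  · exact Finset.insert_subset (Finset.mem_range.2 hcn) h.subset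
  · intro u hu a ha
    rcases Finset.mem_insert.1 ha with rfl | ha
    · rw [hm u hu]
      exact min_le_right _ _
    · exact (hle u hu).trans (h.le_dist u hu a ha)
  · intro u hu
    right
    rcases h.attained u hu with ⟨-, -, h3⟩ | ⟨a, ha, h3⟩
    · exact ⟨c, Finset.mem_insert_self _ _, by rw [hm u hu, min_eq_right (h3 c hcn)]⟩
    · rcases min_choice (m u) (dist (y u) (y c)) with h4 | h4
      · exact ⟨a, Finset.mem_insert_of_mem ha, by rw [hm u hu, h4, h3]⟩
      · exact ⟨c, Finset.mem_insert_self _ _, by rw [hm u hu, h4]⟩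
  · intro u hu a ha b hb hab
    have hu' := hle u hu
    rcases Finset.mem_insert.1 ha with rfl | haS <;>
        rcases Finset.mem_insert.1 hb with rfl | hbS
    · exact absurd rfl hab
    · exact (hsep u hu b hbS).imp (fun h => by linarith) hu'.trans
    · rw [dist_comm]
      exact (hsep u hu a haS).imp (fun h => by linarith) hu'.trans
    · exact (h.far u hu a haS b hbS hab).imp id hu'.trans
  · intro u hu hwu
    have hwu' := hwu.trans_le (hle u hu)
    obtain ⟨h1, h2⟩ := h.uncovered u hu hwu'
    refine ⟨fun a ha => ?_, fun a ha b hb hab => ?_⟩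
    · rcases Finset.mem_insert.1 ha with rfl | ha
      · rcases hc with ⟨-, h3⟩ | ⟨h3, -⟩
        · exact h3 u hu hwu'
        · linarith [h3 u hu]
      · exact h1 a ha
    · rcases Finset.mem_insert.1 ha with rfl | haS <;>
        rcases Finset.mem_insert.1 hb with rfl | hbS
      · exact absurd rfl hab
      · linarith [hsep' u hu hwu' b hbS]
      · rw [dist_comm]
        linarith [hsep' u hu hwu' a haS]
      · exact h2 a haS b hbS hab

/-- If the coverage radii are `2 α` times the fair radii, then the greedy algorithm has computed
a `(2, 2)`-bicriteria approximate solution when it has chosen `k` centers. -/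
theorem isBicriteriaApprox [DecidableEq X] {k : ℕ} {α : ℝ} {r : ℕ → ℝ}
    (h : GreedyInv n y w S m) (hk : 1 ≤ k)
    (hα : 1 ≤ α) (hy : Set.InjOn y (Set.Iio n)) (hS : S.card = k)
    (hr0 : ∀ u < n, 0 ≤ r u) (hw : ∀ u < n, w u = 2 * (α * r u))
    (hr : ∀ u < n, fairRadius ((Finset.range n).image y) k (y u) = r u)
    (hball : ∀ u < n, (((Finset.range n).image y).card : ℝ) / k ≤
      (ball ((Finset.range n).image y) (y u) (r u)).card) :
    IsBicriteriaApprox ((Finset.range n).image y) k α 2 2 (S.image y) := by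
  set P := (Finset.range n).image y with hP
  have hmem : ∀ v, v ∈ P ↔ ∃ u < n, y u = v := fun v => by simp [hP]
  have hSn : ∀ a ∈ S, a < n := fun a ha => Finset.mem_range.1 (h.subset ha)
  have hSne : S.Nonempty := Finset.card_pos.1 (by omega)
  have hwnn : ∀ u < n, 0 ≤ w u := fun u hu => by
    rw [hw u hu]
    have := hr0 u hu
    positivity
  have hdist : ∀ u < n, Metric.infDist (y u) ((S.image y : Finset X) : Set X) ≤ m u := by
    intro u hu
    rcases h.attained u hu with ⟨h0, -⟩ | ⟨c, hc, h1⟩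
    · exact absurd h0 hSne.ne_empty
    · rw [h1]
      exact Metric.infDist_le_dist_of_mem (by simpa using ⟨c, hc, rfl⟩)
  have hnotMem : ∀ u < n, 0 < m u → u ∉ S := by
    intro u hu hpos hmem
    have := h.le_dist u hu u hmem
    rw [dist_self] at this
    linarith
  have hcard : ∀ u < n, 0 < m u → ((Insert.insert u S).image y).card = k + 1 := by
    intro u hu hpos
    rw [Finset.card_image_of_injOn, Finset.card_insert_of_notMem (hnotMem u hu hpos), hS]
    refine hy.mono fun a ha => ?_
    rcases Finset.mem_insert.1 (Finset.mem_coe.1 ha) with rfl | ha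
    · exact hu
    · exact hSn a ha
  -- An uncovered `u` together with `S` would give `k + 1` points with pairwise disjoint fair balls.
  have hcov : ∀ u < n, m u ≤ w u := by
    by_contra! hcon
    obtain ⟨u, hu, hlt⟩ := hcon
    obtain ⟨h1, h2⟩ := h.uncovered u hu hlt
    have hle := card_le_of_separated (P := P) (T := (Insert.insert u S).image y) hk
      (r := fairRadius P k) ?_ ?_ ?_
    · rw [hcard u hu ((hwnn u hu).trans_lt hlt)] at hle
      omega
    · exact Finset.image_subset_image (Finset.insert_subset (Finset.mem_range.2 hu) h.subset)
    · simp only [Finset.mem_image, forall_exists_index, and_imp, forall_apply_eq_imp_iff₂]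
      intro a ha
      have han : a < n := by
        rcases Finset.mem_insert.1 ha with rfl | ha
        · exact hu
        · exact hSn a ha
      rw [hr a han]
      exact hball a han
    -- Halving the hypothesis leaves `α * (r a + r b)` on the left, which is at least `r a + r b`
    -- because `α ≥ 1`.
    · have hbig : ∀ a < n, ∀ b < n, w a + w b < 2 * dist (y a) (y b) →
          fairRadius P k (y a) + fairRadius P k (y b) < dist (y a) (y b) := by
        intro a ha b hb hab
        rw [hw a ha, hw b hb] at hab
        rw [hr a ha, hr b hb]
        nlinarith [hr0 a ha, hr0 b hb]
      simp only [Finset.mem_image, forall_exists_index, and_imp, forall_apply_eq_imp_iff₂]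
      intro a ha b hb hab
      rcases Finset.mem_insert.1 ha with rfl | haS <;>
        rcases Finset.mem_insert.1 hb with rfl | hbS
      · exact absurd rfl hab
      · exact hbig _ hu _ (hSn b hbS) (by linarith [h1 b hbS, h.le_dist _ hu b hbS])
      · refine hbig _ (hSn a haS) _ hu ?_
        rw [dist_comm]
        linarith [h1 a haS, h.le_dist _ hu a haS]
      · exact hbig _ (hSn a haS) _ (hSn b hbS) (h2 a haS b hbS fun e => hab (e ▸ rfl))
  refine ⟨?_, ?_, ?_, ?_⟩
  -- The factor `2` is finite and nonzero, so it moves inside the infima and the cost is compared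
  -- with each fair `C` separately; an empty infimum needs no separate case.
  · rw [optCost, ENNReal.mul_iInf_of_ne (by simp) (by simp)]
    refine le_iInf fun C => ?_
    rw [ENNReal.mul_iInf_of_ne (by simp) (by simp)]
    refine le_iInf fun hC => ?_
    obtain ⟨-, hCk, hCfair⟩ := hC
    have hCne : C.Nonempty := Finset.card_pos.1 (by omega)
    rw [← ENNReal.ofReal_mul (by norm_num)]
    refine ENNReal.ofReal_le_ofReal ?_
    have : Nonempty P := by
      obtain ⟨a, ha⟩ := hSne
      exact ⟨⟨y a, (hmem _).2 ⟨a, hSn a ha, rfl⟩⟩⟩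
    refine ciSup_le fun ⟨v, hv⟩ => ?_
    obtain ⟨u, hu, rfl⟩ := (hmem v).1 hv
    refine (hdist u hu).trans ?_
    -- If `m u > 2 * cost P C`, then `u` and the `k` points of `S` have `k + 1` distinct closest
    -- centers in `C`.
    by_contra! hlt
    have hcost0 : 0 ≤ cost P C := Metric.infDist_nonneg.trans (infDist_le_cost C hv)
    have hle := card_le_of_no_common_center (T := (Insert.insert u S).image y) hCne ?_
    · rw [hcard u hu (by linarith)] at hle
      omega
    · have hfar : ∀ a < n, ∀ b < n, m u ≤ dist (y a) (y b) →
          Metric.infDist (y a) (C : Set X) + Metric.infDist (y b) (C : Set X) <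
            dist (y a) (y b) := by
        intro a ha b hb hab
        linarith [infDist_le_cost C ((hmem _).2 ⟨a, ha, rfl⟩),
          infDist_le_cost C ((hmem _).2 ⟨b, hb, rfl⟩)]
      simp only [Finset.mem_image, forall_exists_index, and_imp, forall_apply_eq_imp_iff₂]
      intro a ha b hb hab
      rcases Finset.mem_insert.1 ha with rfl | haS <;>
        rcases Finset.mem_insert.1 hb with rfl | hbS
      · exact absurd rfl hab
      · exact hfar _ hu _ (hSn b hbS) (h.le_dist _ hu b hbS)
      · refine hfar _ (hSn a haS) _ hu ?_
        rw [dist_comm]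
        exact h.le_dist _ hu a haS
      · have han := hSn a haS
        have hbn := hSn b hbS
        -- In the first case fairness of `C` bounds the two distances to `C` by `α * r a` and `α * r
        -- b`, whose sum is less than `dist (y a) (y b)`; in the second case the cost of `C` bounds
        -- them.
        rcases h.far u hu a haS b hbS (fun e => hab (e ▸ rfl)) with h3 | h3
        · have ha' := hCfair (y a) ((hmem _).2 ⟨a, han, rfl⟩)
          have hb' := hCfair (y b) ((hmem _).2 ⟨b, hbn, rfl⟩)
          rw [hr a han] at ha'
          rw [hr b hbn] at hb'
          rw [hw a han, hw b hbn] at h3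
          linarith
        · exact hfar a han b hbn h3
  · exact Finset.image_subset_image h.subset
  · rw [Finset.card_image_of_injOn (hy.mono fun a ha => hSn a ha), hS]
  · intro v hv
    obtain ⟨u, hu, rfl⟩ := (hmem v).1 hv
    rw [hr u hu, mul_assoc, ← hw u hu]
    exact (hdist u hu).trans (hcov u hu)

end GreedyInv

/-- Bicriteria approximation is monotone in both factors. -/
theorem IsBicriteriaApprox.mono {P S : Finset X} {k : ℕ} {α β γ β' γ' : ℝ}
    (h : IsBicriteriaApprox P k α β γ S) (hβ : β ≤ β') (hγ : γ * α ≤ γ' * α)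
    (hr : ∀ v ∈ P, 0 ≤ fairRadius P k v) : IsBicriteriaApprox P k α β' γ' S :=
  ⟨h.1.trans (mul_le_mul_left (ENNReal.ofReal_le_ofReal hβ) _), h.2.1, h.2.2.1, fun v hv =>
    (h.2.2.2 v hv).trans (mul_le_mul_of_nonneg_right hγ (hr v hv))⟩

end Greedy

/-! ### Unfolding rules for the loop semantics. -/

namespace ForProgram

theorem den_instr (n : ℕ) (i : Instr) (s : Store) : (instr i).den n s = i.exec s := rfl

theorem den_seq (n : ℕ) (p q : ForProgram) (s : Store) :
    (seq p q).den n s = q.den n (p.den n s) := rfl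

theorem den_cond_pos {n : ℕ} {b : Test} {p q : ForProgram} {s : Store} (h : b.holds s) :
    (cond b p q).den n s = p.den n s := if_pos h

theorem den_cond_neg {n : ℕ} {b : Test} {p q : ForProgram} {s : Store} (h : ¬ b.holds s) :
    (cond b p q).den n s = q.den n s := if_neg h

end ForProgram

open ForProgram Instr

local infixr:65 " ⨟ " => ForProgram.seq

/-! ### The algorithm

The natural-number variables `0`, `1`, `2`, `3` and `8` hold `n`, `k`, `1`, `n - 1` and `0`; the
real tables `0`, `1` and `2` hold the distances, the coverage radii and the distances to the
centers chosen so far. -/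

/-- An instruction that does nothing of interest. -/
def skip : ForProgram := instr (iconst 11 0)

/-- Real variable `0` becomes the largest distance. -/
def maxDist : ForProgram :=
  loop 4 (loop 5 (instr (rload 1 0 4 5) ⨟ cond (.rle 0 1) (instr (rcopy 0 1)) skip))

/-- Adds `k` to variable `7` for each point whose distance to the point number `ivar 4` is at most
`rvar 1`. -/
def countBall : ForProgram :=
  loop 6 (instr (rload 2 0 4 6) ⨟ cond (.rle 2 1) (instr (iadd 7 7 1)) skip)

/-- Real variable `3` becomes the fair radius of the point number `ivar 4`. -/
def fairRad : ForProgram :=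
  instr (rcopy 3 0) ⨟ loop 5 (instr (rload 1 0 4 5) ⨟ instr (iconst 7 0) ⨟ countBall ⨟
    cond (.ile 0 7) (cond (.rle 1 3) (instr (rcopy 3 1)) skip) skip)

/-- Real table `1` is filled with the coverage radii, `2 α` times the fair radii. -/
def coverage : ForProgram :=
  loop 4 (fairRad ⨟ instr (rscale 3 0 3) ⨟ instr (radd 3 3 3) ⨟ instr (rstore 1 4 8 3))

/-- Real variable `4` becomes an upper bound for the coverage radii, and real table `2` is filled
with a larger number. -/
def initDist : ForProgram :=
  instr (rscale 4 0 0) ⨟ instr (radd 4 4 4) ⨟ instr (rconst 5 1) ⨟ instr (radd 5 4 5) ⨟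
    loop 4 (instr (rstore 2 4 8 5))

/-- Variable `9` becomes a point farthest from the centers. -/
def farthest : ForProgram :=
  instr (iconst 9 0) ⨟ instr (rload 6 2 9 8) ⨟
    loop 4 (instr (rload 7 2 4 8) ⨟
      cond (.rle 6 7) (instr (icopy 9 4) ⨟ instr (rcopy 6 7)) skip)

/-- Variable `9` becomes an uncovered point of least coverage radius, if there is one. -/
def leastUncovered : ForProgram :=
  instr (rcopy 8 4) ⨟
    loop 4 (instr (rload 6 2 4 8) ⨟ instr (rload 7 1 4 8) ⨟
      cond (.rle 6 7) skip
        (cond (.rle 7 8) (instr (rcopy 8 7) ⨟ instr (icopy 9 4)) skip))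

/-- The point number `ivar 9` is made a center. -/
def addCenter : ForProgram :=
  instr (istore 0 9 8 2) ⨟
    loop 4 (instr (rload 6 0 4 9) ⨟ instr (rload 7 2 4 8) ⨟
      cond (.rle 6 7) (instr (rstore 2 4 8 6)) skip)

/-- The first `k` of `n` rounds choose a center each. -/
def chooseCenters : ForProgram :=
  loop 10 (cond (.ile 1 10) skip (farthest ⨟ leastUncovered ⨟ addCenter))

/-- The greedy algorithm for fair `k`-center, after the variables `2` and `3` have been set. -/
def greedy : ForProgram := maxDist ⨟ coverage ⨟ initDist ⨟ chooseCenters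

/-! ### Correctness of the subroutines. -/

theorem maxDist_spec (n : ℕ) (s : Store) :
    ∀ i < n, ∀ j < n, s.rtab 0 i j ≤ (maxDist.den n s).rvar 0 := by
  refine den_loop_induction (fun i s' => ∀ i' < i, ∀ j < n, s.rtab 0 i' j ≤ s'.rvar 0)
    (by simp) fun i hi s' hf hc hI => ?_
  have hd : s'.rtab 0 = s.rtab 0 := hf.rtab 0 rfl
  have := den_loop_induction (n := n) (c := 5) (s := s')
    (p := instr (rload 1 0 4 5) ⨟ cond (.rle 0 1) (instr (rcopy 0 1)) skip)
    (fun j s'' => s'.rvar 0 ≤ s''.rvar 0 ∧ ∀ j' < j, s.rtab 0 i j' ≤ s''.rvar 0)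
    (by simp [Store.setI]) fun j hj s'' hf' hc' hI' => ?_
  · intro i' hi' j hj
    rcases Nat.lt_succ_iff_lt_or_eq.1 hi' with h | rfl
    · exact (hI i' h j hj).trans this.1
    · exact this.2 j hj
  have hd' : s''.rtab 0 = s.rtab 0 := (hf'.rtab 0 rfl).trans hd
  have hi4 : s''.ivar 4 = i := (hf'.ivar 4 rfl).trans hc
  rw [den_seq]
  by_cases h : s''.rvar 0 ≤ s.rtab 0 i j
  · rw [den_cond_pos (by simpa [den_instr, exec, Test.holds, hd', hi4, hc'] using h)]
    simp only [den_instr, exec, Store.setI, hd', hi4, hc', Function.update_self]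
    refine ⟨hI'.1.trans h, fun j' hj' => ?_⟩
    rcases Nat.lt_succ_iff_lt_or_eq.1 hj' with h' | rfl
    · exact (hI'.2 j' h').trans h
    · exact le_rfl
  · rw [den_cond_neg (by simpa [den_instr, exec, Test.holds, hd', hi4, hc'] using h)]
    simp only [den_instr, exec, Store.setI, skip]
    refine ⟨by simpa using hI'.1, fun j' hj' => ?_⟩
    rcases Nat.lt_succ_iff_lt_or_eq.1 hj' with h' | rfl
    · simpa using hI'.2 j' h'
    · simpa using (not_le.1 h).le

/-- Adding `k` per point makes the condition `|ball| ≥ n / k` testable as `n ≤ |ball| * k`, on a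
machine that neither multiplies nor divides naturals. -/
theorem countBall_spec (n : ℕ) (s : Store) :
    (countBall.den n s).ivar 7 = s.ivar 7 +
      ((Finset.range n).filter fun x => s.rtab 0 (s.ivar 4) x ≤ s.rvar 1).card * s.ivar 1 := by
  refine den_loop_induction (fun i s' => s'.ivar 7 = s.ivar 7 +
      ((Finset.range i).filter fun x => s.rtab 0 (s.ivar 4) x ≤ s.rvar 1).card * s.ivar 1)
    (by simp [Store.setI]) fun i hi s' hf hc hI => ?_
  have hd : s'.rtab 0 = s.rtab 0 := hf.rtab 0 rfl
  have h4 : s'.ivar 4 = s.ivar 4 := hf.ivar 4 rfl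
  have h1 : s'.ivar 1 = s.ivar 1 := hf.ivar 1 rfl
  have hr1 : s'.rvar 1 = s.rvar 1 := hf.rvar 1 rfl
  rw [den_seq, Finset.range_add_one, Finset.filter_insert]
  by_cases h : s.rtab 0 (s.ivar 4) i ≤ s.rvar 1
  · rw [den_cond_pos (by simpa [den_instr, exec, Test.holds, hd, h4, hc, hr1] using h), if_pos h,
      Finset.card_insert_of_notMem (by simp)]
    simp [den_instr, exec, Store.setI, hI, h1]
    ring
  · rw [den_cond_neg (by simpa [den_instr, exec, Test.holds, hd, h4, hc, hr1] using h), if_neg h]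
    simp [den_instr, exec, Store.setI, hI, skip]

/-- The ball of radius `q` around the point `v` has at least `n / k` points. -/
def LargeRadius (n k : ℕ) (d : ℕ → ℕ → ℝ) (v : ℕ) (q : ℝ) : Prop :=
  n ≤ ((Finset.range n).filter fun x => d v x ≤ q).card * k

/-- The radius `q` is large for `v` and minimal with this property among the distances from `v`;
moreover it lies between `0` and `D`. -/
structure IsFairRadius (n k : ℕ) (d : ℕ → ℕ → ℝ) (D : ℝ) (v : ℕ) (q : ℝ) : Prop where
  nonneg : 0 ≤ q
  le : q ≤ D
  large : LargeRadius n k d v q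
  min : ∀ u < n, LargeRadius n k d v (d v u) → q ≤ d v u

/-- The candidate starts at the bound in real variable `0`, assumed to be large, and is lowered to
each large distance that does not exceed it, so it remains large throughout. -/
theorem fairRad_spec (n : ℕ) (s : Store) (hn : s.ivar 0 = n) (hd0 : ∀ i j, 0 ≤ s.rtab 0 i j)
    (hD0 : 0 ≤ s.rvar 0)
    (hD : LargeRadius n (s.ivar 1) (s.rtab 0) (s.ivar 4) (s.rvar 0)) :
    IsFairRadius n (s.ivar 1) (s.rtab 0) (s.rvar 0) (s.ivar 4) ((fairRad.den n s).rvar 3) := by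
  have := den_loop_induction (n := n) (c := 5) (s := (rcopy 3 0).exec s)
    (p := instr (rload 1 0 4 5) ⨟ instr (iconst 7 0) ⨟ countBall ⨟
      cond (.ile 0 7) (cond (.rle 1 3) (instr (rcopy 3 1)) skip) skip)
    (fun i s' => 0 ≤ s'.rvar 3 ∧ s'.rvar 3 ≤ s.rvar 0 ∧
      LargeRadius n (s.ivar 1) (s.rtab 0) (s.ivar 4) (s'.rvar 3) ∧
      ∀ u < i, LargeRadius n (s.ivar 1) (s.rtab 0) (s.ivar 4) (s.rtab 0 (s.ivar 4) u) →
        s'.rvar 3 ≤ s.rtab 0 (s.ivar 4) u)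
    (by simpa [Store.setI, exec] using ⟨hD0, hD⟩) fun i hi s' hf hc hI => ?_
  · exact ⟨this.1, this.2.1, this.2.2.1, this.2.2.2⟩
  have hd : s'.rtab 0 = s.rtab 0 := hf.rtab 0 rfl
  have h0 : s'.ivar 0 = n := (hf.ivar 0 rfl).trans hn
  have h1 : s'.ivar 1 = s.ivar 1 := hf.ivar 1 rfl
  have h4 : s'.ivar 4 = s.ivar 4 := hf.ivar 4 rfl
  rw [den_seq, den_seq, den_seq]
  set s₁ := (instr (iconst 7 0)).den n ((instr (rload 1 0 4 5)).den n s') with hs₁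
  have hcount := countBall_spec n s₁
  have hf2 := frame_den n countBall s₁
  have e0 : (countBall.den n s₁).ivar 0 = n := by
    rw [hf2.ivar 0 rfl]; simpa [hs₁, den_instr, exec] using h0
  have e1 : (countBall.den n s₁).rvar 1 = s.rtab 0 (s.ivar 4) i := by
    rw [hf2.rvar 1 rfl]; simp [hs₁, den_instr, exec, hd, h4, hc]
  have e3 : (countBall.den n s₁).rvar 3 = s'.rvar 3 := by
    rw [hf2.rvar 3 rfl]; simp [hs₁, den_instr, exec]
  have e7 : n ≤ (countBall.den n s₁).ivar 7 ↔
      LargeRadius n (s.ivar 1) (s.rtab 0) (s.ivar 4) (s.rtab 0 (s.ivar 4) i) := by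
    rw [hcount, LargeRadius]
    simp [hs₁, den_instr, exec, hd, h4, hc, h1]
  obtain ⟨hI0, hI1, hI2, hI3⟩ := hI
  by_cases hL : LargeRadius n (s.ivar 1) (s.rtab 0) (s.ivar 4) (s.rtab 0 (s.ivar 4) i)
  · rw [den_cond_pos (by simpa only [Test.holds, e0, e7] using hL)]
    by_cases hle : s.rtab 0 (s.ivar 4) i ≤ s'.rvar 3
    · rw [den_cond_pos (by simpa only [Test.holds, e1, e3] using hle)]
      simp only [den_instr, exec, Store.setI, e1, Function.update_self]
      refine ⟨hd0 _ _, hle.trans hI1, hL, fun u hu hLu => ?_⟩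
      rcases Nat.lt_succ_iff_lt_or_eq.1 hu with h | rfl
      · exact hle.trans (hI3 u h hLu)
      · exact le_rfl
    · rw [den_cond_neg (by simpa only [Test.holds, e1, e3] using hle)]
      simp only [den_instr, exec, Store.setI, skip, e3]
      refine ⟨hI0, hI1, hI2, fun u hu hLu => ?_⟩
      rcases Nat.lt_succ_iff_lt_or_eq.1 hu with h | rfl
      · exact hI3 u h hLu
      · exact (not_le.1 hle).le
  · rw [den_cond_neg (by simpa only [Test.holds, e0, e7] using hL)]
    simp only [den_instr, exec, Store.setI, skip, e3]
    refine ⟨hI0, hI1, hI2, fun u hu hLu => ?_⟩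
    rcases Nat.lt_succ_iff_lt_or_eq.1 hu with h | rfl
    · exact hI3 u h hLu
    · exact absurd hLu hL

theorem coverage_spec (n : ℕ) (s : Store) (hn : s.ivar 0 = n) (h8 : s.ivar 8 = 0)
    (hd0 : ∀ i j, 0 ≤ s.rtab 0 i j)
    (hD0 : 0 ≤ s.rvar 0)
    (hD : ∀ v < n, LargeRadius n (s.ivar 1) (s.rtab 0) v (s.rvar 0)) :
    ∀ v < n, ∃ q, IsFairRadius n (s.ivar 1) (s.rtab 0) (s.rvar 0) v q ∧
      (coverage.den n s).rtab 1 v 0 = 2 * (s.par 0 * q) := by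
  refine den_loop_induction
    (fun i s' => ∀ v < i, ∃ q, IsFairRadius n (s.ivar 1) (s.rtab 0) (s.rvar 0) v q ∧
      s'.rtab 1 v 0 = 2 * (s.par 0 * q))
    (by simp) fun i hi s' hf hc hI => ?_
  have e0 : s'.ivar 0 = n := (hf.ivar 0 rfl).trans hn
  have e1 : s'.ivar 1 = s.ivar 1 := hf.ivar 1 rfl
  have e8 : s'.ivar 8 = 0 := (hf.ivar 8 rfl).trans h8
  have ed : s'.rtab 0 = s.rtab 0 := hf.rtab 0 rfl
  have eD : s'.rvar 0 = s.rvar 0 := hf.rvar 0 rfl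
  have hr := fairRad_spec n s' e0 (by rwa [ed]) (by rwa [eD]) (by
    rw [e1, ed, eD, hc]
    exact hD i hi)
  rw [e1, ed, eD, hc] at hr
  have hf2 := frame_den n fairRad s'
  have g4 := (hf2.ivar 4 rfl).trans hc
  have g8 := (hf2.ivar 8 rfl).trans e8
  have gt : (fairRad.den n s').rtab 1 = s'.rtab 1 := hf2.rtab 1 rfl
  have gp : (fairRad.den n s').par = s.par := hf2.par.trans hf.par
  intro v hv
  rcases Nat.lt_succ_iff_lt_or_eq.1 hv with h | rfl
  · obtain ⟨q, hq, hq'⟩ := hI v h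
    refine ⟨q, hq, ?_⟩
    simpa [den_seq, den_instr, exec, Store.setI, setEntry, g4, gt, h.ne] using hq'
  · refine ⟨_, hr, ?_⟩
    simp [den_seq, den_instr, exec, Store.setI, setEntry, g4, g8, gp]
    ring

/-- The summand `1` makes the initial value strictly larger than the bound `2 * α * D` on the
coverage radii, `D` being real variable `0`. -/
theorem initDist_spec (n : ℕ) (s : Store) (h8 : s.ivar 8 = 0) :
    (initDist.den n s).rvar 4 = 2 * (s.par 0 * s.rvar 0) ∧
      ∀ u < n, (initDist.den n s).rtab 2 u 0 = 2 * (s.par 0 * s.rvar 0) + 1 := by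
  simp only [initDist, den_seq, den_instr]
  set s₁ := (radd 5 4 5).exec ((rconst 5 1).exec ((radd 4 4 4).exec ((rscale 4 0 0).exec s)))
    with hs₁
  have h4 : s₁.rvar 4 = 2 * (s.par 0 * s.rvar 0) := by
    simp [hs₁, exec]
    ring
  have h5 : s₁.rvar 5 = 2 * (s.par 0 * s.rvar 0) + 1 := by
    simp [hs₁, exec]
    ring
  refine ⟨((frame_den n (loop 4 (instr (rstore 2 4 8 5))) s₁).rvar 4 rfl).trans h4, ?_⟩
  refine den_loop_induction (fun i s' => ∀ u < i, s'.rtab 2 u 0 = 2 * (s.par 0 * s.rvar 0) + 1)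
    (by simp) fun i hi s' hf hc hI => ?_
  have e5 : s'.rvar 5 = s₁.rvar 5 := hf.rvar 5 rfl
  have e8 : s'.ivar 8 = 0 := (hf.ivar 8 rfl).trans h8
  intro u hu
  rcases Nat.lt_succ_iff_lt_or_eq.1 hu with h | rfl
  · simpa [den_instr, exec, Store.setI, setEntry, hc, h.ne] using hI u h
  · simp [den_instr, exec, Store.setI, setEntry, hc, e8, e5, h5]

theorem farthest_spec (n : ℕ) (s : Store) (hn : 0 < n) (h8 : s.ivar 8 = 0) :
    (farthest.den n s).ivar 9 < n ∧
      ∀ u < n, s.rtab 2 u 0 ≤ s.rtab 2 ((farthest.den n s).ivar 9) 0 := by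
  have := den_loop_induction (n := n) (c := 4) (s := (rload 6 2 9 8).exec ((iconst 9 0).exec s))
    (p := instr (rload 7 2 4 8) ⨟
      cond (.rle 6 7) (instr (icopy 9 4) ⨟ instr (rcopy 6 7)) skip)
    (fun i s' => s'.ivar 9 < n ∧ s'.rvar 6 = s.rtab 2 (s'.ivar 9) 0 ∧
      ∀ u < i, s.rtab 2 u 0 ≤ s'.rvar 6)
    (by simp [exec, Store.setI, hn, h8]) fun i hi s' hf hc hI => ?_
  · obtain ⟨h1, h2, h3⟩ := this
    exact ⟨h1, fun u hu => (h3 u hu).trans h2.le⟩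
  have ed : s'.rtab 2 = s.rtab 2 := hf.rtab 2 rfl
  have e8 : s'.ivar 8 = 0 := (hf.ivar 8 rfl).trans h8
  obtain ⟨h1, h2, h3⟩ := hI
  rw [den_seq]
  by_cases h : s'.rvar 6 ≤ s.rtab 2 i 0
  · rw [den_cond_pos (by simpa [den_instr, exec, Test.holds, ed, e8, hc] using h)]
    simp only [den_seq, den_instr, exec, Store.setI, hc, ed, e8]
    refine ⟨by simpa using hi, by simp, fun u hu => ?_⟩
    rcases Nat.lt_succ_iff_lt_or_eq.1 hu with h' | rfl
    · simpa using (h3 u h').trans h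
    · simp
  · rw [den_cond_neg (by simpa [den_instr, exec, Test.holds, ed, e8, hc] using h)]
    simp only [den_instr, exec, Store.setI, skip]
    refine ⟨by simpa using h1, by simpa using h2, fun u hu => ?_⟩
    rcases Nat.lt_succ_iff_lt_or_eq.1 hu with h' | rfl
    · simpa using h3 u h'
    · simpa using (not_le.1 h).le

/-- Variable `9` enters holding a farthest point and is overwritten only by uncovered points, so the
two selection rules combine without a flag. The invariant distinguishes whether an uncovered point
has been met. -/
theorem leastUncovered_spec (n : ℕ) (s : Store) (h8 : s.ivar 8 = 0) (hb : s.ivar 9 < n)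
    (hfar : ∀ u < n, s.rtab 2 u 0 ≤ s.rtab 2 (s.ivar 9) 0)
    (hW : ∀ u < n, s.rtab 1 u 0 ≤ s.rvar 4) :
    IsChoice n (s.rtab 1 · 0) (s.rtab 2 · 0) ((leastUncovered.den n s).ivar 9) := by
  have := den_loop_induction (n := n) (c := 4) (s := (rcopy 8 4).exec s)
    (p := instr (rload 6 2 4 8) ⨟ instr (rload 7 1 4 8) ⨟
      cond (.rle 6 7) skip
        (cond (.rle 7 8) (instr (rcopy 8 7) ⨟ instr (icopy 9 4)) skip))
    (fun i s' => s'.ivar 9 < n ∧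
      ((s'.ivar 9 = s.ivar 9 ∧ s'.rvar 8 = s.rvar 4 ∧ ∀ u < i, s.rtab 2 u 0 ≤ s.rtab 1 u 0) ∨
      (s'.rvar 8 = s.rtab 1 (s'.ivar 9) 0 ∧
        s.rtab 1 (s'.ivar 9) 0 < s.rtab 2 (s'.ivar 9) 0 ∧
        ∀ u < i, s.rtab 1 u 0 < s.rtab 2 u 0 → s.rtab 1 (s'.ivar 9) 0 ≤ s.rtab 1 u 0)))
    (by simpa [exec, Store.setI] using hb) fun i hi s' hf hc hI => ?_
  · obtain ⟨h1, ⟨h2, -, h3⟩ | ⟨-, h2, h3⟩⟩ := this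
    · refine ⟨h1, .inr ⟨h3, fun u hu => (hfar u hu).trans (le_of_eq ?_)⟩⟩
      exact congrArg (s.rtab 2 · 0) h2.symm
    · exact ⟨h1, .inl ⟨h2, h3⟩⟩
  have e1 : s'.rtab 1 = s.rtab 1 := hf.rtab 1 rfl
  have e2 : s'.rtab 2 = s.rtab 2 := hf.rtab 2 rfl
  have e8 : s'.ivar 8 = 0 := (hf.ivar 8 rfl).trans h8
  obtain ⟨h1, hI⟩ := hI
  rw [den_seq, den_seq]
  by_cases h : s.rtab 2 i 0 ≤ s.rtab 1 i 0
  · rw [den_cond_pos (by simpa [den_instr, exec, Test.holds, e1, e2, e8, hc] using h)]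
    simp only [den_instr, exec, Store.setI, skip]
    refine ⟨by simpa using h1, hI.imp (fun ⟨h2, h3, h4⟩ => ?_) fun ⟨h2, h3, h4⟩ => ?_⟩
    · refine ⟨by simpa using h2, by simpa using h3, fun u hu => ?_⟩
      rcases Nat.lt_succ_iff_lt_or_eq.1 hu with h' | rfl
      · exact h4 u h'
      · exact h
    · refine ⟨by simpa using h2, by simpa using h3, fun u hu hlt => ?_⟩
      rcases Nat.lt_succ_iff_lt_or_eq.1 hu with h' | rfl
      · simpa using h4 u h' hlt
      · exact absurd h hlt.not_ge
  rw [den_cond_neg (by simpa [den_instr, exec, Test.holds, e1, e2, e8, hc] using h)]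
  by_cases h' : s.rtab 1 i 0 ≤ s'.rvar 8
  · rw [den_cond_pos (by simpa [den_instr, exec, Test.holds, e1, e8, hc] using h')]
    simp only [den_seq, den_instr, exec, Store.setI, hc, e1, e2, e8]
    refine ⟨by simpa using hi, .inr ⟨by simp, by simpa using h, fun u hu hlt => ?_⟩⟩
    rcases Nat.lt_succ_iff_lt_or_eq.1 hu with hu' | rfl
    · rcases hI with ⟨-, -, h4⟩ | ⟨h2, -, h4⟩
      · exact absurd (h4 u hu') hlt.not_ge
      · simpa using h'.trans (h2.le.trans (h4 u hu' hlt))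
    · simp
  · rw [den_cond_neg (by simpa [den_instr, exec, Test.holds, e1, e8, hc] using h')]
    simp only [den_instr, exec, Store.setI, skip]
    rcases hI with ⟨-, h3, -⟩ | ⟨h2, h3, h4⟩
    -- Before any uncovered point is met, real variable `8` still holds the upper bound of the
    -- coverage radii, so the first one cannot fail the comparison.
    · exact absurd (h3 ▸ hW i hi) h'
    · refine ⟨by simpa using h1, .inr ⟨by simpa using h2, by simpa using h3, fun u hu hlt => ?_⟩⟩
      rcases Nat.lt_succ_iff_lt_or_eq.1 hu with hu' | rfl
      · simpa using h4 u hu' hlt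
      · simpa using h2.symm.le.trans (not_le.1 h').le

theorem addCenter_spec (n : ℕ) (s : Store) (h2 : s.ivar 2 = 1) (h8 : s.ivar 8 = 0) :
    (∀ j, (addCenter.den n s).itab 0 j 0 = if j = s.ivar 9 then 1 else s.itab 0 j 0) ∧
      ∀ u < n, (addCenter.den n s).rtab 2 u 0 =
        min (s.rtab 2 u 0) (s.rtab 0 u (s.ivar 9)) := by
  simp only [addCenter, den_seq, den_instr]
  set s₁ := (istore 0 9 8 2).exec s with hs₁
  constructor
  · intro j
    rw [(frame_den n _ s₁).itab 0 rfl]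
    simp [hs₁, exec, setEntry, h8, h2]
  -- The table is updated in place, so the invariant must also record that the entries not yet
  -- visited keep their old values.
  suffices h : ∀ u < n, (den n (loop 4 (instr (rload 6 0 4 9) ⨟ instr (rload 7 2 4 8) ⨟
      cond (.rle 6 7) (instr (rstore 2 4 8 6)) skip)) s₁).rtab 2 u 0 =
        if u < n then min (s.rtab 2 u 0) (s.rtab 0 u (s.ivar 9)) else s.rtab 2 u 0 from
    fun u hu => by rw [h u hu, if_pos hu]
  refine den_loop_induction (fun i s' => ∀ u < n, s'.rtab 2 u 0 =
      if u < i then min (s.rtab 2 u 0) (s.rtab 0 u (s.ivar 9)) else s.rtab 2 u 0)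
    (by simp [hs₁, exec, Store.setI]) fun i hi s' hf hc hI u hu => ?_
  have e0 : s'.rtab 0 = s.rtab 0 := hf.rtab 0 rfl
  have e8 : s'.ivar 8 = 0 := (hf.ivar 8 rfl).trans h8
  have e9 : s'.ivar 9 = s.ivar 9 := hf.ivar 9 rfl
  have hi2 : s'.rtab 2 i 0 = s.rtab 2 i 0 := by simpa using hI i hi
  rw [den_seq, den_seq]
  by_cases h : s.rtab 0 i (s.ivar 9) ≤ s.rtab 2 i 0
  · rw [den_cond_pos (by simpa [den_instr, exec, Test.holds, e0, e8, e9, hc, hi2] using h)]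
    simp only [den_instr, exec, Store.setI, setEntry, hc, e0, e8, e9]
    rcases eq_or_ne u i with rfl | hne
    · simp [h]
    · simp [hne, hI u hu, hne.le_iff_lt]
  · rw [den_cond_neg (by simpa [den_instr, exec, Test.holds, e0, e8, e9, hc, hi2] using h)]
    simp only [den_instr, exec, Store.setI, skip]
    rcases eq_or_ne u i with rfl | hne
    · simp [hi2, (not_le.1 h).le]
    · simp [hI u hu, hne.le_iff_lt]

/-- All loops have length `n`, so the rounds from number `k` on are idle; after `i` rounds there are
`min i k` centers. -/
theorem chooseCenters_spec {X : Type*} [MetricSpace X] (n : ℕ) (s : Store) (y : ℕ → X)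
    (hy : Set.InjOn y (Set.Iio n))
    (hd : ∀ i < n, ∀ j < n, s.rtab 0 i j = dist (y i) (y j)) (hkn : s.ivar 1 ≤ n)
    (h2 : s.ivar 2 = 1) (h8 : s.ivar 8 = 0) (hw0 : ∀ u < n, 0 ≤ s.rtab 1 u 0)
    (hW : ∀ u < n, s.rtab 1 u 0 ≤ s.rvar 4)
    (hout : ∀ j < n, s.itab 0 j 0 = 0)
    (hinv : GreedyInv n y (s.rtab 1 · 0) ∅ (s.rtab 2 · 0)) :
    ∃ (S : Finset ℕ) (m : ℕ → ℝ), GreedyInv n y (s.rtab 1 · 0) S m ∧ S.card = s.ivar 1 ∧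
      ∀ j < n, (chooseCenters.den n s).itab 0 j 0 = 1 ↔ j ∈ S := by
  have := den_loop_induction (n := n) (c := 10) (s := s)
    (p := cond (.ile 1 10) skip (farthest ⨟ leastUncovered ⨟ addCenter))
    (fun i s' => ∃ S : Finset ℕ, GreedyInv n y (s.rtab 1 · 0) S (s'.rtab 2 · 0) ∧
      S.card = min i (s.ivar 1) ∧ ∀ j < n, s'.itab 0 j 0 = 1 ↔ j ∈ S)
    ⟨∅, hinv, by simp, fun j hj => by simp [Store.setI, hout j hj]⟩ fun i hi s' hf hc hI => ?_
  · obtain ⟨S, h, hc, ho⟩ := this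
    exact ⟨S, _, h, by rw [hc, min_eq_right hkn], ho⟩
  obtain ⟨S, hS, hcard, ho⟩ := hI
  have e1 : s'.ivar 1 = s.ivar 1 := hf.ivar 1 rfl
  have e2 : s'.ivar 2 = 1 := (hf.ivar 2 rfl).trans h2
  have e8 : s'.ivar 8 = 0 := (hf.ivar 8 rfl).trans h8
  have er4 : s'.rvar 4 = s.rvar 4 := hf.rvar 4 rfl
  have et0 : s'.rtab 0 = s.rtab 0 := hf.rtab 0 rfl
  have et1 : s'.rtab 1 = s.rtab 1 := hf.rtab 1 rfl
  by_cases hki : s.ivar 1 ≤ i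
  · rw [den_cond_pos (by simpa [Test.holds, e1, hc] using hki)]
    refine ⟨S, by simpa [den_instr, exec, Store.setI, skip] using hS, ?_, ?_⟩
    · rw [hcard]
      omega
    · simpa [den_instr, exec, Store.setI, skip] using ho
  · rw [den_cond_neg (by simpa [Test.holds, e1, hc] using hki), den_seq, den_seq]
    obtain ⟨hb, hfar⟩ := farthest_spec n s' (by omega) e8
    set s₁ := farthest.den n s' with hs₁
    have f1 := frame_den n farthest s'
    rw [← hs₁] at f1
    have ht1 : s₁.rtab 1 = s.rtab 1 := (f1.rtab 1 rfl).trans et1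
    have ht2 : s₁.rtab 2 = s'.rtab 2 := f1.rtab 2 rfl
    have hch := leastUncovered_spec n s₁ ((f1.ivar 8 rfl).trans e8) hb
      (by rwa [ht2]) (by rwa [ht1, f1.rvar 4 rfl, er4])
    rw [ht1, ht2] at hch
    set s₂ := leastUncovered.den n s₁ with hs₂
    have f2 := frame_den n leastUncovered s₁
    rw [← hs₂] at f2
    obtain ⟨ha, hm⟩ := addCenter_spec n s₂ ((f2.ivar 2 rfl).trans ((f1.ivar 2 rfl).trans e2))
      ((f2.ivar 8 rfl).trans ((f1.ivar 8 rfl).trans e8))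
    rw [(f2.rtab 2 rfl).trans ht2, (f2.rtab 0 rfl).trans ((f1.rtab 0 rfl).trans et0)] at hm
    rw [(f2.itab 0 rfl).trans (f1.itab 0 rfl)] at ha
    refine ⟨insert (s₂.ivar 9) S, hS.insert hch fun u hu => ?_, ?_, fun j hj => ?_⟩
    · rw [← hd u hu _ hch.1]
      exact hm u hu
    · rw [Finset.card_insert_of_notMem (hS.notMem_of_isChoice hw0 hy (by omega) hch), hcard]
      omega
    · rw [Finset.mem_insert, ← ho j hj]
      simp only [Store.setI, ha]
      split_ifs with h <;> simp [h]

/-! ### Assembling the algorithm and the theorem. -/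

/-- The greedy algorithm computes a `(2, 2)`-bicriteria approximate solution. -/
theorem greedy_spec {X : Type*} [MetricSpace X] {n k : ℕ} (x : Fin n ↪ X) {α : ℝ} (s : Store)
    (hk : 1 ≤ k) (hkn : k ≤ n) (hα : 1 ≤ α) (h0 : s.ivar 0 = n) (h1 : s.ivar 1 = k)
    (h2 : s.ivar 2 = 1) (h8 : s.ivar 8 = 0) (hp : s.par 0 = α)
    (hit : ∀ j, s.itab 0 j 0 = 0) (hd0 : ∀ i j, 0 ≤ s.rtab 0 i j)
    (hd : ∀ i j : Fin n, s.rtab 0 i j = dist (x i) (x j)) :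
    IsBicriteriaApprox (Finset.univ.map x) k α 2 2 (outputSet x (greedy.den n s)) ∧
      ∀ v ∈ Finset.univ.map x, 0 ≤ fairRadius (Finset.univ.map x) k v := by
  classical
  have hn : 0 < n := by omega
  -- The points are indexed by all naturals, as in the machine's tables; the value beyond `n` is
  -- arbitrary.
  set y : ℕ → X := fun i => if h : i < n then x ⟨i, h⟩ else x ⟨0, hn⟩ with hydef
  have hyx : ∀ i (hi : i < n), y i = x ⟨i, hi⟩ := fun i hi => by simp [hydef, hi]
  have hyd : ∀ i < n, ∀ j < n, s.rtab 0 i j = dist (y i) (y j) := fun i hi j hj => by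
    rw [hyx i hi, hyx j hj, ← hd]
  have hy : Set.InjOn y (Set.Iio n) := fun i hi j hj hij => by
    rw [hyx i hi, hyx j hj] at hij
    exact congrArg Fin.val (x.injective hij)
  have hP : Finset.univ.map x = (Finset.range n).image y := by
    ext v
    simp only [Finset.mem_map, Finset.mem_univ, true_and, Finset.mem_image, Finset.mem_range]
    exact ⟨fun ⟨i, hi⟩ => ⟨i, i.2, (hyx i i.2).trans hi⟩,
      fun ⟨i, hi, h⟩ => ⟨⟨i, hi⟩, (hyx i hi).symm.trans h⟩⟩
  have hPcard : ((Finset.range n).image y).card = n := by simp [← hP]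
  simp only [greedy, den_seq]
  -- the largest distance
  have hmax := maxDist_spec n s
  have f1 := frame_den n maxDist s
  set s₁ := maxDist.den n s
  have hD0 : 0 ≤ s₁.rvar 0 := (hd0 0 0).trans (hmax 0 hn 0 hn)
  -- the coverage radii
  have hcov := coverage_spec n s₁ ((f1.ivar 0 rfl).trans h0) ((f1.ivar 8 rfl).trans h8)
    (by rwa [f1.rtab 0 rfl]) hD0 (fun v hv => by
      rw [f1.rtab 0 rfl, f1.ivar 1 rfl, h1, LargeRadius, Finset.filter_true_of_mem
        fun j hj => hmax v hv j (Finset.mem_range.1 hj), Finset.card_range]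
      exact Nat.le_mul_of_pos_right n hk)
  rw [f1.rtab 0 rfl, f1.ivar 1 rfl, f1.par, h1, hp] at hcov
  have f2 := frame_den n coverage s₁
  set s₂ := coverage.den n s₁
  -- The bound `v < n` is moved under the existential so that `choose` yields a function on all of
  -- `ℕ`.
  have hrad : ∀ v, ∃ q, v < n → IsFairRadius n k (s.rtab 0) (s₁.rvar 0) v q ∧
      s₂.rtab 1 v 0 = 2 * (α * q) := fun v => by
    by_cases hv : v < n
    · obtain ⟨q, hq⟩ := hcov v hv
      exact ⟨q, fun _ => hq⟩
    · exact ⟨0, fun h => absurd h hv⟩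
  choose r hr using hrad
  -- the initial distances
  obtain ⟨hW, hB⟩ := initDist_spec n s₂ ((f2.ivar 8 rfl).trans ((f1.ivar 8 rfl).trans h8))
  rw [f2.par.trans f1.par, hp, f2.rvar 0 rfl] at hW hB
  have f3 := frame_den n initDist s₂
  set s₃ := initDist.den n s₂
  have ht1 : s₃.rtab 1 = s₂.rtab 1 := f3.rtab 1 rfl
  have ht0 : s₃.rtab 0 = s.rtab 0 := (f3.rtab 0 rfl).trans ((f2.rtab 0 rfl).trans (f1.rtab 0 rfl))
  have hi1 : s₃.ivar 1 = k :=
    (f3.ivar 1 rfl).trans ((f2.ivar 1 rfl).trans ((f1.ivar 1 rfl).trans h1))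
  have hw : ∀ u < n, s₃.rtab 1 u 0 = 2 * (α * r u) := fun u hu => by rw [ht1, (hr u hu).2]
  have hwle : ∀ u < n, s₃.rtab 1 u 0 ≤ 2 * (α * s₁.rvar 0) := fun u hu => by
    rw [hw u hu]
    have := mul_le_mul_of_nonneg_left (hr u hu).1.le (zero_le_one.trans hα)
    linarith
  have hw0 : ∀ u < n, 0 ≤ s₃.rtab 1 u 0 := fun u hu => by
    rw [hw u hu]
    have := mul_nonneg (zero_le_one.trans hα) (hr u hu).1.nonneg
    linarith
  -- the centers
  obtain ⟨S, m, hS, hScard, hSout⟩ := chooseCenters_spec n s₃ y hy (by rwa [ht0])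
    (by rw [hi1]; exact hkn)
    ((f3.ivar 2 rfl).trans ((f2.ivar 2 rfl).trans ((f1.ivar 2 rfl).trans h2)))
    ((f3.ivar 8 rfl).trans ((f2.ivar 8 rfl).trans ((f1.ivar 8 rfl).trans h8)))
    hw0 (fun u hu => by rw [hW]; exact hwle u hu)
    (fun j _ => by
      rw [(f3.itab 0 rfl).trans ((f2.itab 0 rfl).trans (f1.itab 0 rfl))]
      exact hit j)
    (GreedyInv.empty (fun u hu => (hwle u hu).trans_lt (lt_add_one _)) (fun u hu v hv => by
      rw [← hyd u hu v hv]
      -- The initial value dominates every distance: with `D` the bound on the distances, `D ≤ 2 * α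
      -- * D + 1` because `α ≥ 1` and `D ≥ 0`.
      nlinarith [hmax u hu v hv]) hB)
  have hout : outputSet x (chooseCenters.den n s₃) = S.image y := by
    ext v
    simp only [outputSet, Finset.mem_map, Finset.mem_filter, Finset.mem_univ, true_and,
      Finset.mem_image]
    constructor
    · rintro ⟨i, hi, rfl⟩
      exact ⟨i, (hSout i i.2).1 hi, hyx i i.2⟩
    · rintro ⟨i, hi, rfl⟩
      have hin := Finset.mem_range.1 (hS.subset hi)
      exact ⟨⟨i, hin⟩, (hSout i hin).2 hi, (hyx i hin).symm⟩
  -- the fair radii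
  have hball : ∀ v < n, ∀ q, (ball ((Finset.range n).image y) (y v) q).card =
      ((Finset.range n).filter fun u => s.rtab 0 v u ≤ q).card := by
    intro v hv q
    rw [← Finset.card_image_of_injOn (s := (Finset.range n).filter fun u => s.rtab 0 v u ≤ q)
      (f := y) (hy.mono fun a ha => by
        simpa using (Finset.mem_filter.1 (Finset.mem_coe.1 ha)).1)]
    congr 1
    ext z
    simp only [mem_ball, Finset.mem_image, Finset.mem_filter, Finset.mem_range]
    constructor
    · rintro ⟨⟨u, hu, rfl⟩, hle⟩
      exact ⟨u, ⟨hu, (hyd v hv u hu).trans_le hle⟩, rfl⟩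
    · rintro ⟨u, ⟨hu, hle⟩, rfl⟩
      exact ⟨⟨u, hu, rfl⟩, (hyd v hv u hu).symm.trans_le hle⟩
  have hlarge : ∀ v < n, ∀ q, (((Finset.range n).image y).card : ℝ) / k ≤
      (ball ((Finset.range n).image y) (y v) q).card ↔ LargeRadius n k (s.rtab 0) v q := by
    intro v hv q
    rw [hPcard, hball v hv, div_le_iff₀ (by exact_mod_cast hk), LargeRadius]
    exact_mod_cast Iff.rfl
  have hfair : ∀ u < n, fairRadius ((Finset.range n).image y) k (y u) = r u := by
    intro u hu
    refine fairRadius_eq hk (Finset.mem_image_of_mem y (Finset.mem_range.2 hu))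
      ((hlarge u hu _).2 (hr u hu).1.large) fun z hz hzl => ?_
    obtain ⟨v, hv, rfl⟩ := Finset.mem_image.1 hz
    have hv := Finset.mem_range.1 hv
    rw [hlarge u hu, ← hyd u hu v hv] at hzl
    rw [← hyd u hu v hv]
    exact (hr u hu).1.min v hv hzl
  rw [hP, hout]
  refine ⟨hS.isBicriteriaApprox hk hα hy (hScard.trans hi1) (fun u hu => (hr u hu).1.nonneg) hw
    hfair fun u hu => (hlarge u hu _).2 (hr u hu).1.large, fun v hv => ?_⟩
  obtain ⟨u, hu, rfl⟩ := Finset.mem_image.1 hv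
  rw [hfair u (Finset.mem_range.1 hu)]
  exact (hr u (Finset.mem_range.1 hu)).1.nonneg

end FairKCenter

theorem mainTheorem3 :
    ∃ (A : FairKCenter.Program) (T : Polynomial ℕ),
      ∀ (X : Type*) [MetricSpace X] (n k : ℕ) (x : Fin n ↪ X) (α ε : ℝ),
        1 ≤ k → k ≤ n → 1 ≤ α → 0 < ε →
          ∃ (s : FairKCenter.Store) (t : ℕ),
            FairKCenter.Runs A (FairKCenter.inputStore x k α ε) s t ∧
            t ≤ T.eval n ∧
            FairKCenter.IsBicriteriaApprox (Finset.univ.map x) k α (3 + ε) 3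
              (FairKCenter.outputSet x s) := by
  open FairKCenter in
  -- The two leading instructions set the variables `2` and `3` to `1` and `n - 1` for the
  -- translated loops and account for the `+ 2`. As `1 ≤ k ≤ n`, the truncated subtraction is exact.
  refine ⟨.seq (.instr (.iconst 2 1)) (.seq (.instr (.isub 3 0 2)) greedy.compile),
    greedy.time + 2, fun X _ n k x α ε hk hkn hα hε => ?_⟩
  set s := (Instr.isub 3 0 2).exec ((Instr.iconst 2 1).exec (inputStore x k α ε)) with hs
  obtain ⟨t, ht, htle⟩ := ForProgram.runs_compile (n := n) greedy rfl rfl rfl s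
    (by simp [hs, Instr.exec]) (by simp [hs, Instr.exec, inputStore]; omega)
  refine ⟨greedy.den n s, 1 + (1 + t), .seq (.instr _ _) (.seq (.instr _ _) ht), ?_, ?_⟩
  · simp only [Polynomial.eval_add, Polynomial.eval_ofNat]
    omega
  obtain ⟨h, hr⟩ := greedy_spec x s hk hkn hα (by simp [hs, Instr.exec, inputStore])
    (by simp [hs, Instr.exec, inputStore]) (by simp [hs, Instr.exec])
    (by simp [hs, Instr.exec, inputStore]) (by simp [hs, Instr.exec, inputStore])
    (by simp [hs, Instr.exec, inputStore])
    (fun i j => by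
      simp only [hs, Instr.exec, inputStore]
      split_ifs
      · exact dist_nonneg
      · exact le_rfl)
    (fun i j => by simp [hs, Instr.exec, inputStore])
  -- The factors `(2, 2)` are relaxed to `(3 + ε, 3)`; nonnegativity of the fair radii allows
  -- increasing the fairness factor.
  exact h.mono (by linarith) (by linarith) hr
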